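/- All graphs are finite, simple and undirected. A *connection model* with labels from a finite set $\Lambda$ is a finite rooted tree in which every leaf $x$ carries a label $\lambda(x)\in\Lambda$ and every non-leaf node $v$ carries a symmetric relation $C(v)\subseteq\Lambda\times\Lambda$; it defines the graph on its leaves in which two distinct leaves $x,y$ are adjacent iff $(\lambda(x),\lambda(y))\in C(v)$, where $v$ is the least common ancestor of $x$ and $y$. A class $\mathscr C$ of graphs has *bounded shrubdepth* if there are $h\in\mathbb N$ and a finite set $\Lambda$ such that every $G\in\mathscr C$ has (up to isomorphism) a connection model of depth at most $h$ with labels from $\Lambda$. Structures are finite, over finite signatures of relation symbols and unary function symbols, the latter interpreted as partial functions; graphs are structures over one binary relation symbol $E$. Atomic formulas are $R(\tau_1,\dots,\tau_k)$, $\tau_1=\tau_2$ and $\mathrm{dom}_f(\tau)$ ("$\tau$ lies in the domain of $f$"), where the $\tau_i$ are terms, that is, compositions of function symbols applied to a variable; an atomic formula with an undefined term is false. A *transduction* is a nondeterministic operation from structures to structures, composed of finitely many atomic operations of the following kinds, each creating only symbols not already present and using only symbols that are present: (i) extension by a new relation defined by a formula $\varphi(x_1,\dots,x_k)$; (ii)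 restriction to the substructure induced by the elements satisfying a formula $\psi(x)$, where functions become undefined at arguments whose value is removed; (iii) reduct: removing a relation symbol or a function symbol; (iv) copying: taking the disjoint union of two copies of the structure, with a new unary predicate marking the new elements and a new symmetric binary relation joining each element to its copy; (v) extension by a new partial function $f$ defined by a formula $\varphi(x,y)$, where $f(x)$ is the unique $y$ with $\varphi(x,y)$ and is undefined if there is no unique such $y$; (vi) unary lift, given by an arbitrary map $\sigma$ sending each structure $\mathbb A$ to a nonempty family $\sigma(\mathbb A)$ of subsets of its universe: adding a new unary predicate interpreted as a nondeterministically chosen member of $\sigma(\mathbb A)$. A transduction is *almost quantifier-free* if all formulas occurring in it are quantifier-free. **Lemma.** Let $\mathscr C$ be a class of graphs of bounded shrubdepth. Then there are an almost quantifier-free transduction $\mathsf F$ and a unary function symbol $g$ such that for every $G\in\mathscr C$, $\mathsf F$ is defined on $G$ (it has at least one output), and every output of $\mathsf F$ on $G$ is equal to $G$ enriched by a total function $g\colon V(G)\to V(G)$ such that, for all $v,w\in V(G)$, $g(v)=g(w)$ if and only if $v$ and $w$ lie in the same connected component of $G$. -/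

import Mathlib

universe u

/-! ### Signatures and structures -/

/-- A relation symbol of a prescribed arity (possibly `0`), from a countable supply of names. -/
structure RelSym where
  name : ℕ
  arity : ℕ
  deriving DecidableEq

/-- Unary function symbols, from a countable supply of names. -/
abbrev FunSym := ℕ

/-- A signature: a finite set of relation symbols and unary function symbols. -/
structure Signature where
  rels : Finset RelSym
  fns : Finset FunSym

/-- A finite structure together with its signature. Function symbols are interpreted as *partial*
functions, encoded as maps to `Option V`. The fields `rel` and `fn` are indexed by all symbols only
for convenience: the last two fields say that a symbol outside the signature carries no
information, so a structure amounts to a signature, a finite universe (possibly empty), and an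
interpretation of the symbols of the signature. -/
structure FinStr : Type (u + 1) where
  sig : Signature
  V : Type u
  finite : Finite V
  rel : (R : RelSym) → (Fin R.arity → V) → Prop
  fn : FunSym → V → Option V
  rel_eq_false : ∀ R, R ∉ sig.rels → rel R = fun _ => False
  fn_eq_none : ∀ f, f ∉ sig.fns → fn f = fun _ => none

/-! ### First-order formulas -/

/-- Terms with variable in `Fin n`: compositions of function symbols applied to a variable. -/
inductive FOTerm (n : ℕ) : Type
  | var (i : Fin n) : FOTerm n
  | app (f : FunSym) (t : FOTerm n) : FOTerm n

/-- First-order formulas with free variables in `Fin n`. -/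
inductive FOFormula : ℕ → Type
  | falsum {n : ℕ} : FOFormula n
  | rel {n : ℕ} (R : RelSym) (t : Fin R.arity → FOTerm n) : FOFormula n
  | eq {n : ℕ} (s t : FOTerm n) : FOFormula n
  | dom {n : ℕ} (f : FunSym) (t : FOTerm n) : FOFormula n
  | neg {n : ℕ} (φ : FOFormula n) : FOFormula n
  | and {n : ℕ} (φ ψ : FOFormula n) : FOFormula n
  | or {n : ℕ} (φ ψ : FOFormula n) : FOFormula n
  | ex {n : ℕ} (φ : FOFormula (n + 1)) : FOFormula n
  | all {n : ℕ} (φ : FOFormula (n + 1)) : FOFormula n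

/-- All function symbols of the term belong to the signature. -/
def FOTerm.Over {n : ℕ} (S : Signature) : FOTerm n → Prop
  | .var _ => True
  | .app f t => f ∈ S.fns ∧ t.Over S

/-- All symbols of the formula belong to the signature. -/
def FOFormula.Over (S : Signature) : {n : ℕ} → FOFormula n → Prop
  | _, .falsum => True
  | _, .rel R t => R ∈ S.rels ∧ ∀ i, (t i).Over S
  | _, .eq s t => s.Over S ∧ t.Over S
  | _, .dom f t => f ∈ S.fns ∧ t.Over S
  | _, .neg φ => φ.Over S
  | _, .and φ ψ => φ.Over S ∧ ψ.Over S
  | _, .or φ ψ => φ.Over S ∧ ψ.Over S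
  | _, .ex φ => φ.Over S
  | _, .all φ => φ.Over S

/-- Quantifier-free formulas. -/
def FOFormula.IsQF : {n : ℕ} → FOFormula n → Prop
  | _, .falsum => True
  | _, .rel _ _ => True
  | _, .eq _ _ => True
  | _, .dom _ _ => True
  | _, .neg φ => φ.IsQF
  | _, .and φ ψ => φ.IsQF ∧ ψ.IsQF
  | _, .or φ ψ => φ.IsQF ∧ ψ.IsQF
  | _, .ex _ => False
  | _, .all _ => False

/-- The value of a term, `none` if undefined. -/
def FOTerm.eval (A : FinStr.{u}) {n : ℕ} (x : Fin n → A.V) : FOTerm n → Option A.V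
  | .var i => some (x i)
  | .app f t => (t.eval A x).bind (A.fn f)

/-- Satisfaction; an atomic formula is false if one of its terms is undefined. -/
def FOFormula.Holds (A : FinStr.{u}) : {n : ℕ} → FOFormula n → (Fin n → A.V) → Prop
  | _, .falsum, _ => False
  | _, .rel R t, x => ∃ v : Fin R.arity → A.V, (∀ i, (t i).eval A x = some (v i)) ∧ A.rel R v
  | _, .eq s t, x => ∃ v : A.V, s.eval A x = some v ∧ t.eval A x = some v
  | _, .dom f t, x => ∃ v w : A.V, t.eval A x = some v ∧ A.fn f v = some w
  | _, .neg φ, x => ¬ φ.Holds A x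
  | _, .and φ ψ, x => φ.Holds A x ∧ ψ.Holds A x
  | _, .or φ ψ, x => φ.Holds A x ∨ ψ.Holds A x
  | _, .ex φ, x => ∃ a : A.V, φ.Holds A (Fin.snoc x a)
  | _, .all φ, x => ∀ a : A.V, φ.Holds A (Fin.snoc x a)

/-! ### Operations on structures -/

namespace FinStr

/-- `A` with the symbol `R` added to the signature and interpreted as `P`. -/
def addRel (A : FinStr.{u}) (R : RelSym) (P : (Fin R.arity → A.V) → Prop) : FinStr.{u} where
  sig := ⟨insert R A.sig.rels, A.sig.fns⟩
  V := A.V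
  finite := A.finite
  rel := Function.update A.rel R P
  fn := A.fn
  rel_eq_false := by
    intro R' h
    rw [Finset.mem_insert, not_or] at h
    rw [Function.update_of_ne h.1, A.rel_eq_false R' h.2]
  fn_eq_none := A.fn_eq_none

/-- `A` with the function symbol `f` added and interpreted as the partial function `F`. -/
def addFn (A : FinStr.{u}) (f : FunSym) (F : A.V → Option A.V) : FinStr.{u} where
  sig := ⟨A.sig.rels, insert f A.sig.fns⟩
  V := A.V
  finite := A.finite
  rel := A.rel
  fn := Function.update A.fn f F
  rel_eq_false := A.rel_eq_false
  fn_eq_none := by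
    intro f' h
    rw [Finset.mem_insert, not_or] at h
    rw [Function.update_of_ne h.1, A.fn_eq_none f' h.2]

/-- `A` with the relation symbol `R` removed. -/
def dropRel (A : FinStr.{u}) (R : RelSym) : FinStr.{u} where
  sig := ⟨A.sig.rels.erase R, A.sig.fns⟩
  V := A.V
  finite := A.finite
  rel := Function.update A.rel R (fun _ => False)
  fn := A.fn
  rel_eq_false := by
    intro R' h
    by_cases hR : R' = R
    · subst hR
      exact Function.update_self ..
    · rw [Function.update_of_ne hR]
      exact A.rel_eq_false R' fun h' => h (Finset.mem_erase.2 ⟨hR, h'⟩)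
  fn_eq_none := A.fn_eq_none

/-- `A` with the function symbol `f` removed. -/
def dropFn (A : FinStr.{u}) (f : FunSym) : FinStr.{u} where
  sig := ⟨A.sig.rels, A.sig.fns.erase f⟩
  V := A.V
  finite := A.finite
  rel := A.rel
  fn := Function.update A.fn f (fun _ => none)
  rel_eq_false := A.rel_eq_false
  fn_eq_none := by
    intro f' h
    by_cases hf : f' = f
    · subst hf
      exact Function.update_self ..
    · rw [Function.update_of_ne hf]
      exact A.fn_eq_none f' fun h' => h (Finset.mem_erase.2 ⟨hf, h'⟩)

open Classical in
/-- The substructure of `A` induced by `X`; functions become undefined where they leave `X`. -/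
noncomputable def induce (A : FinStr.{u}) (X : Set A.V) : FinStr.{u} where
  sig := A.sig
  V := {x : A.V // x ∈ X}
  finite := haveI := A.finite; inferInstance
  rel := fun R v => A.rel R fun i => (v i).1
  fn := fun f x => (A.fn f x.1).bind fun y => if h : y ∈ X then some ⟨y, h⟩ else none
  rel_eq_false := by
    intro R h
    funext v
    simp [A.rel_eq_false R h]
  fn_eq_none := by
    intro f h
    funext x
    simp [A.fn_eq_none f h]

/-- The disjoint union of two copies of `A`. -/
def double (A : FinStr.{u}) : FinStr.{u} where
  sig := A.sig
  V := A.V ⊕ A.V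
  finite := haveI := A.finite; inferInstance
  rel := fun R v => (∃ w, A.rel R w ∧ v = fun i => Sum.inl (w i)) ∨
    (∃ w, A.rel R w ∧ v = fun i => Sum.inr (w i))
  fn := fun f => Sum.elim (fun x => (A.fn f x).map Sum.inl) (fun x => (A.fn f x).map Sum.inr)
  rel_eq_false := by
    intro R h
    funext v
    simp [A.rel_eq_false R h]
  fn_eq_none := by
    intro f h
    funext x
    cases x <;> simp [A.fn_eq_none f h]

/-- Two disjoint copies of `A`, with a new unary predicate `P` marking the newly created vertices
and a new symmetric binary relation `M` connecting each vertex with its copy. -/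
def copy (A : FinStr.{u}) (P M : ℕ) : FinStr.{u} :=
  (A.double.addRel ⟨P, 1⟩ (fun v => ∃ a : A.V, v 0 = Sum.inr a)).addRel ⟨M, 2⟩
    (fun v => ∃ a : A.V, (v 0 = Sum.inl a ∧ v 1 = Sum.inr a) ∨ (v 0 = Sum.inr a ∧ v 1 = Sum.inl a))

end FinStr

open Classical in
/-- The partial function `x ↦` the unique `y` with `Q x y` (undefined if there is no unique `y`). -/
noncomputable def uniqueChoice {V : Type u} (Q : V → V → Prop) (x : V) : Option V :=
  if h : ∃! y, Q x y then some h.choose else none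

/-! ### Transductions -/

/-- Atomic operations. A unary lift is parameterized by an arbitrary map `σ` sending each structure
to a nonempty family of subsets of its universe. -/
inductive AtomicOp : Type (u + 1)
  | extension (R : RelSym) (φ : FOFormula R.arity) : AtomicOp
  | restriction (ψ : FOFormula 1) : AtomicOp
  | relReduct (R : RelSym) : AtomicOp
  | fnReduct (f : FunSym) : AtomicOp
  | copying (P M : ℕ) : AtomicOp
  | fnExtension (f : FunSym) (φ : FOFormula 2) : AtomicOp
  | lift (X : ℕ) (σ : (A : FinStr.{u}) → Set (Set A.V)) (hσ : ∀ A, (σ A).Nonempty) : AtomicOp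

/-- The set of possible outputs of an atomic operation. The operation is undefined on `A`, i.e. has
no output, if a formula uses a symbol that `A` does not carry, if a symbol to be removed is absent,
or if a symbol to be created is already present. Whether it is defined depends only on the
signature of `A`. -/
def AtomicOp.outputs : AtomicOp.{u} → FinStr.{u} → Set FinStr.{u}
  | .extension R φ, A =>
      {B | R ∉ A.sig.rels ∧ φ.Over A.sig ∧ B = A.addRel R (fun v => φ.Holds A v)}
  | .restriction ψ, A => {B | ψ.Over A.sig ∧ B = A.induce {x | ψ.Holds A ![x]}}
  | .relReduct R, A => {B | R ∈ A.sig.rels ∧ B = A.dropRel R}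
  | .fnReduct f, A => {B | f ∈ A.sig.fns ∧ B = A.dropFn f}
  | .copying P M, A =>
      {B | (⟨P, 1⟩ : RelSym) ∉ A.sig.rels ∧ (⟨M, 2⟩ : RelSym) ∉ A.sig.rels ∧ B = A.copy P M}
  | .fnExtension f φ, A =>
      {B | f ∉ A.sig.fns ∧ φ.Over A.sig ∧
        B = A.addFn f (uniqueChoice fun x y => φ.Holds A ![x, y])}
  | .lift X σ _, A =>
      {B | (⟨X, 1⟩ : RelSym) ∉ A.sig.rels ∧ ∃ U ∈ σ A, B = A.addRel ⟨X, 1⟩ (fun v => v 0 ∈ U)}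

/-- All formulas parameterizing the operation are quantifier-free. -/
def AtomicOp.IsQF : AtomicOp.{u} → Prop
  | .extension _ φ => φ.IsQF
  | .restriction ψ => ψ.IsQF
  | .fnExtension _ φ => φ.IsQF
  | .relReduct _ => True
  | .fnReduct _ => True
  | .copying _ _ => True
  | .lift _ _ _ => True

/-- Transductions: compositions of atomic operations. -/
inductive Transduction : Type (u + 1)
  | atomic (op : AtomicOp.{u}) : Transduction
  | comp (I J : Transduction) : Transduction

/-- The set of possible outputs of a transduction; `comp I J` applies `I` first. -/
def Transduction.outputs : Transduction.{u} → FinStr.{u} → Set FinStr.{u}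
  | .atomic op, A => op.outputs A
  | .comp I J, A => {B | ∃ A' ∈ I.outputs A, B ∈ J.outputs A'}

/-- A transduction is almost quantifier-free if all formulas parameterizing the atomic operations
comprising it are quantifier-free. -/
def Transduction.IsAlmostQF : Transduction.{u} → Prop
  | .atomic op => op.IsQF
  | .comp I J => I.IsAlmostQF ∧ J.IsAlmostQF

/-! ### Graphs and shrubdepth -/

/-- Finite simple graphs. -/
structure FinGraph : Type (u + 1) where
  V : Type u
  finite : Finite V
  graph : SimpleGraph V

/-- The binary relation symbol for edges. -/
def edgeSym : RelSym := ⟨0, 2⟩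

/-- A graph as a structure over the signature consisting of the edge symbol only. -/
def FinGraph.toStr (G : FinGraph.{u}) : FinStr.{u} :=
  FinStr.addRel
    { sig := ⟨∅, ∅⟩
      V := G.V
      finite := G.finite
      rel := fun _ _ => False
      fn := fun _ _ => none
      rel_eq_false := fun _ _ => rfl
      fn_eq_none := fun _ _ => rfl }
    edgeSym (fun v : Fin 2 → G.V => G.graph.Adj (v 0) (v 1))

/-- A connection model with labels from `Λ`: a finite rooted tree whose leaves (the maximal
elements of the tree order, whose least element is the root) carry labels, and whose nodes carry
symmetric binary relations on `Λ`. Only the relations at non-leaf nodes matter. -/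
structure ConnectionModel (Λ : Type) : Type (u + 1) where
  tree : RootedTree.{u}
  finite : Finite tree
  label : {x : tree // IsMax x} → Λ
  C : tree → Λ → Λ → Prop
  symm : ∀ v a b, C v a b → C v b a

/-- The graph on the leaves defined by a connection model; `x ⊓ y` is the least common ancestor. -/
def ConnectionModel.graph {Λ : Type} (M : ConnectionModel.{u} Λ) :
    SimpleGraph {x : M.tree // IsMax x} where
  Adj x y := x ≠ y ∧ M.C (x.1 ⊓ y.1) (M.label x) (M.label y)
  symm := ⟨fun x y h => ⟨h.1.symm, by
    rw [inf_comm]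
    exact M.symm _ _ _ h.2⟩⟩
  loopless := ⟨fun _ h => h.1 rfl⟩

/-- The depth is at most `h`: from every node, `h` steps to the parent lead to the root (the
parent map `Order.pred` fixes the root). -/
def ConnectionModel.DepthLE {Λ : Type} (M : ConnectionModel.{u} Λ) (h : ℕ) : Prop :=
  ∀ x : M.tree, Order.pred^[h] x = ⊥

/-- A class of graphs has bounded shrubdepth if, for some `h` and some finite set of labels, all
its members have connection models of depth at most `h` using these labels. -/
def BoundedShrubdepth (𝒞 : Set FinGraph.{u}) : Prop :=
  ∃ (h : ℕ) (Λ : Type), Finite Λ ∧ ∀ G ∈ 𝒞, ∃ M : ConnectionModel.{u} Λ,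
    M.DepthLE h ∧ Nonempty (G.graph ≃g M.graph)

/-! Each vertex can find a representative of its component by following parents in a breadth-first
tree. Two facts about bounded shrubdepth make this expressible without quantifiers. Induced paths
have bounded length (`Layered.exists_path_bound`), so distances within components are at most some
constant `d`, and `d` parent steps, hence a single term, lead from any vertex to its root. For any
set `B`, boundedly many subsets of `B` suffice for every vertex with a neighbour in `B` to have
exactly one neighbour in one of them (`Layered.exists_unique_neighbor`). With breadth-first layers
as `B`, a bounded number of unary predicates encodes the parents: one family tells a vertex which
subset to consult, the other consists of the subsets, and the parent is the only neighbour there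
(`Layered.exists_guides`). Unary lifts supply these predicates. Both facts are proved by induction
on the depth of the model: the leaves under a node fall into classes, one per child, and adjacency
across classes depends only on labels. -/

/-! ### Combinatorics of layered sets -/

/-- `S` splits recursively, `n` times, into parts whose mutual adjacency is determined by labels,
ending with parts that have at most one element. -/
def Layered {V : Type u} {Λ : Type} (E : V → V → Prop) (lab : V → Λ) : ℕ → Set V → Prop
  | 0, S => S.Subsingleton
  | n + 1, S => ∃ (c : Setoid V) (C : Λ → Λ → Prop),
      (∀ x ∈ S, Layered E lab n {y ∈ S | c.r x y}) ∧
      ∀ x ∈ S, ∀ y ∈ S, ¬ c.r x y → (E x y ↔ C (lab x) (lab y))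

namespace Layered

variable {V : Type u} {Λ : Type} {E : V → V → Prop} {lab : V → Λ}

lemma mono {n : ℕ} {S T : Set V} (hT : Layered E lab n T) (h : S ⊆ T) : Layered E lab n S := by
  induction n generalizing S T with
  | zero => exact Set.Subsingleton.anti hT h
  | succ n ih =>
    obtain ⟨c, C, h1, h2⟩ := hT
    exact ⟨c, C, fun x hx => ih (h1 x (h hx)) fun y hy => ⟨h hy.1, hy.2⟩,
      fun x hx y hy => h2 x (h hx) y (h hy)⟩

lemma of_subsingleton (n : ℕ) {S : Set V} (hS : S.Subsingleton) : Layered E lab n S := by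
  induction n generalizing S with
  | zero => exact hS
  | succ n ih =>
    exact ⟨⊤, fun _ _ => True, fun x _ => ih (hS.anti fun y hy => hy.1),
      fun x _ y _ h => absurd trivial h⟩

/-- Induced paths in layered graphs have bounded length. -/
theorem exists_path_bound (Λ : Type) [Finite Λ] (n : ℕ) :
    ∃ d : ℕ, ∀ {V : Type u} {E : V → V → Prop} {lab : V → Λ} {S : Set V}, Layered E lab n S →
      (∀ x y, E x y → E y x) → ∀ (l : ℕ) (p : ℕ → V), (∀ i ≤ l, p i ∈ S) →
      (∀ i < l, E (p i) (p (i + 1))) → (∀ i j, i + 2 ≤ j → j ≤ l → ¬ E (p i) (p j)) → l ≤ d := by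
  classical
  have := Fintype.ofFinite Λ
  induction n with
  | zero =>
    -- The bound is 1 and not 0 because `E` may have loops.
    refine ⟨1, fun {V E lab S} hS _ l p hp hE hn => ?_⟩
    by_contra! hl
    apply hn 0 2 le_rfl hl
    rw [hS (hp 2 hl) (hp 1 hl.le)]
    exact hE 0 (by omega)
  | succ n ih =>
    obtain ⟨d, hd⟩ := ih
    -- The path is cut into enough blocks for three of them to agree on a pair of labels. By
    -- induction the first `d + 1` edges of a block cannot all stay in one class; the two further
    -- edges keep the class changes of different blocks at least 3 apart.
    refine ⟨(Fintype.card (Λ × Λ) * 2 + 1) * (d + 3), fun {V E lab S} hS hsymm l p hp hE hn => ?_⟩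
    by_contra! hl
    obtain ⟨c, C, hc, hC⟩ := hS
    have hin : ∀ t : Fin (Fintype.card (Λ × Λ) * 2 + 1), t * (d + 3) + (d + 3) ≤ l := fun t => by
      have := Nat.mul_le_mul_right (d + 3) (Nat.succ_le_of_lt t.2)
      rw [Nat.succ_mul] at this
      omega
    have hsw : ∀ t : Fin (Fintype.card (Λ × Λ) * 2 + 1), ∃ i, t * (d + 3) ≤ i ∧
        i ≤ t * (d + 3) + d ∧ ¬ c.r (p i) (p (i + 1)) := by
      intro t
      have ht := hin t
      by_contra! hno
      have hcl : ∀ j ≤ d + 1, c.r (p (t * (d + 3))) (p (t * (d + 3) + j)) := by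
        intro j hj
        induction j with
        | zero => exact c.refl' _
        | succ j ihj => exact c.trans' (ihj (by omega)) (hno _ (by omega) (by omega))
      have := hd (hc _ (hp (t * (d + 3)) (by omega))) hsymm (d + 1) (fun j => p (t * (d + 3) + j))
        (fun j hj => ⟨hp _ (by omega), hcl j hj⟩) (fun j hj => hE _ (by omega))
        (fun i j hij hj => hn _ _ (by omega) (by omega))
      omega
    choose s hs1 hs2 hs3 using hsw
    obtain ⟨⟨a, b⟩, hab⟩ := Fintype.exists_lt_card_fiber_of_mul_lt_card
      (fun t => (lab (p (s t)), lab (p (s t + 1)))) (n := 2) (by simp)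
    obtain ⟨t₁, t₂, t₃, h₁, h₂, h₃, h₁₂, h₁₃, h₂₃⟩ := Finset.two_lt_card_iff.1 hab
    simp only [Finset.mem_filter, Finset.mem_univ, true_and, Prod.mk.injEq] at h₁ h₂ h₃
    have hCab : C a b := by
      rw [← h₁.1, ← h₁.2, ← hC _ (hp _ ?_) _ (hp _ ?_) (hs3 t₁)]
      · exact hE _ (by have := hin t₁; have := hs2 t₁; omega)
      · have := hin t₁; have := hs2 t₁; omega
      · have := hin t₁; have := hs2 t₁; omega
    have far : ∀ t t', t < t' → s t + 3 ≤ s t' := fun t t' h => by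
      have h' := Nat.mul_le_mul_right (d + 3) (Nat.succ_le_of_lt (Fin.lt_def.1 h))
      rw [Nat.succ_mul] at h'
      have := hs2 t; have := hs1 t'
      omega
    -- Across classes these labels would force an edge, which would be a chord of the path.
    have key : ∀ t t', t ≠ t' → lab (p (s t)) = a → lab (p (s t' + 1)) = b →
        c.r (p (s t)) (p (s t' + 1)) := by
      intro t t' hne ha hb
      have := hin t; have := hs2 t; have := hin t'; have := hs2 t'
      by_contra hcr
      have hadj : E (p (s t)) (p (s t' + 1)) := by
        rw [hC _ (hp _ (by omega)) _ (hp _ (by omega)) hcr, ha, hb]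
        exact hCab
      rcases lt_or_gt_of_ne hne with h | h
      · have := far _ _ h
        exact hn _ _ (by omega) (by omega) hadj
      · have := far _ _ h
        exact hn _ _ (by omega) (by omega) (hsymm _ _ hadj)
    -- The third change serves as a detour linking the two ends of the first, which were supposed to
    -- lie in different classes.
    exact hs3 t₁ (c.trans' (key t₁ t₂ h₁₂ h₁.1 h₂.2) (c.trans' (c.symm'
      (key t₃ t₂ h₂₃.symm h₃.1 h₂.2)) (key t₃ t₁ h₁₃.symm h₃.1 h₁.2)))

/-- In a layered graph, every set `B` has boundedly many subsets such that each vertex with a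
neighbour in `B` has exactly one neighbour in one of these subsets. -/
theorem exists_unique_neighbor (Λ : Type) [Finite Λ] (n : ℕ) :
    ∃ ι : Type, Finite ι ∧ ∀ {V : Type u} {E : V → V → Prop} {lab : V → Λ} {S : Set V},
      Layered E lab n S → ∀ B ⊆ S, ∃ Bs : ι → Set V, (∀ i, Bs i ⊆ B) ∧
        ∀ a ∈ S, (∃ y ∈ B, E a y) → ∃ i, ∃! y, y ∈ Bs i ∧ E a y := by
  classical
  induction n with
  | zero =>
    refine ⟨Unit, inferInstance, fun {V E lab S} hS B hB => ⟨fun _ => B, fun _ => subset_rfl, ?_⟩⟩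
    rintro a - ⟨y, hy, hay⟩
    exact ⟨(), y, ⟨hy, hay⟩, fun z hz => hS (hB hz.1) (hB hy)⟩
  | succ n ih =>
    obtain ⟨ι, hι, ih⟩ := ih
    -- For each label `b` of the neighbour sought: the inductive subsets, for neighbours in the
    -- vertex's own class, and two singletons, for neighbours outside it.
    refine ⟨Λ × (ι ⊕ Bool), inferInstance, fun {V E lab S} hS B hB => ?_⟩
    obtain ⟨c, C, hc, hC⟩ := hS
    have hf : ∀ (T : Set V) (b : Λ), ∃ Bs : ι → Set V, Layered E lab n T →
        (∀ i, Bs i ⊆ {y | y ∈ B ∧ y ∈ T ∧ lab y = b}) ∧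
          ∀ a ∈ T, (∃ y ∈ {y | y ∈ B ∧ y ∈ T ∧ lab y = b}, E a y) →
            ∃ i, ∃! y, y ∈ Bs i ∧ E a y := by
      intro T b
      by_cases hT : Layered E lab n T
      · obtain ⟨Bs, h⟩ := ih hT {y | y ∈ B ∧ y ∈ T ∧ lab y = b} fun y hy => hy.2.1
        exact ⟨Bs, fun _ => h⟩
      · exact ⟨fun _ => ∅, fun h => absurd h hT⟩
    choose f hf using hf
    -- Two `b`-labelled vertices of `B` in different classes suffice, since no class contains both.
    -- If there are no two such vertices, any single one does.
    have hs : ∀ b : Λ, ∃ s : Bool → Set V, (∀ t, s t ⊆ B) ∧ ∀ a ∈ S, C (lab a) b →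
        (∃ y ∈ B, lab y = b ∧ ¬ c.r a y) → ∃ t, ∃! y, y ∈ s t ∧ E a y := by
      intro b
      have single : ∀ a ∈ S, C (lab a) b → ∀ y ∈ B, lab y = b → ¬ c.r a y →
          ∃! z, z ∈ ({y} : Set V) ∧ E a z := fun a ha hab y hy hyb hay =>
        ⟨y, ⟨rfl, (hC a ha y (hB hy) hay).2 (hyb ▸ hab)⟩, fun z hz => hz.1⟩
      by_cases h2 : ∃ y ∈ B, ∃ z ∈ B, lab y = b ∧ lab z = b ∧ ¬ c.r y z
      · obtain ⟨y, hy, z, hz, hyb, hzb, hyz⟩ := h2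
        refine ⟨fun t => if t then {y} else {z}, ?_, ?_⟩
        · rintro (_ | _) <;> simpa
        · rintro a ha hab -
          by_cases hay : c.r a y
          · refine ⟨false, single a ha hab z hz hzb fun haz => hyz ?_⟩
            exact c.trans' (c.symm' hay) haz
          · exact ⟨true, single a ha hab y hy hyb hay⟩
      · push Not at h2
        by_cases h1 : ∃ y ∈ B, lab y = b
        · obtain ⟨y, hy, hyb⟩ := h1
          refine ⟨fun _ => {y}, by simpa, ?_⟩
          rintro a ha hab ⟨z, hz, hzb, haz⟩
          exact ⟨true, single a ha hab y hy hyb fun hay =>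
            haz (c.trans' hay (h2 y hy z hz hyb hzb))⟩
        · push Not at h1
          refine ⟨fun _ => ∅, by simp, ?_⟩
          rintro a ha hab ⟨z, hz, hzb, haz⟩
          exact absurd hzb (h1 z hz)
    choose s hsB hs using hs
    have hcls : ∀ x y, c.r x y → {z ∈ S | c.r x z} = {z ∈ S | c.r y z} := fun x y h => by
      ext z
      exact and_congr_right fun _ => ⟨c.trans' (c.symm' h), c.trans' h⟩
    -- The inductive subsets of all classes are united. They were chosen as a function of the class
    -- as a set, so the union does not depend on representatives.
    refine ⟨fun k => match k with
      | (b, .inl i) => {y ∈ B | y ∈ f {z ∈ S | c.r y z} b i}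
      | (b, .inr t) => s b t, ?_, ?_⟩
    · rintro ⟨b, i | t⟩
      · exact fun y hy => hy.1
      · exact hsB b t
    · rintro a ha ⟨y, hy, hay⟩
      by_cases h : C (lab a) (lab y) ∧ ∃ z ∈ B, lab z = lab y ∧ ¬ c.r a z
      · obtain ⟨t, ht⟩ := hs (lab y) a ha h.1 h.2
        exact ⟨(lab y, .inr t), ht⟩
      -- In this case all neighbours of `a` in `B` with the label of `y` lie in the class of `a`, so
      -- the subsets of other classes add no second neighbour.
      · have own : ∀ z ∈ B, lab z = lab y → E a z → c.r a z := fun z hz hzy haz => by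
          by_contra hcr
          exact h ⟨hzy ▸ (hC a ha z (hB hz) hcr).1 haz, z, hz, hzy, hcr⟩
        obtain ⟨hsub, hun⟩ := hf {z ∈ S | c.r a z} (lab y) (hc a ha)
        obtain ⟨i, z, ⟨hz, haz⟩, hzu⟩ := hun a ⟨ha, c.refl' a⟩
          ⟨y, ⟨hy, ⟨hB hy, own y hy rfl hay⟩, rfl⟩, hay⟩
        have hzz := hsub i hz
        refine ⟨(lab y, .inl i), z, ⟨⟨hzz.1, ?_⟩, haz⟩, ?_⟩
        · rwa [← hcls a z hzz.2.1.2]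
        · rintro w ⟨⟨hwB, hw⟩, haw⟩
          have hlw := ((hf _ (lab y) (hc w (hB hwB))).1 i hw).2.2
          rw [← hcls a w (own w hwB hlw haw)] at hw
          exact hzu w ⟨hw, haw⟩

end Layered

/-! ### From connection models to layered sets -/

/-- The graph of a connection model is layered. -/
theorem ConnectionModel.layered {Λ : Type} (M : ConnectionModel.{u} Λ) {V : Type u}
    (f : V ≃ {x : M.tree // IsMax x}) (n : ℕ) (v : M.tree)
    (hv : ∀ x, v ≤ x → Order.pred^[n] x ≤ v) :
    Layered (fun x y => M.graph.Adj (f x) (f y)) (fun x => M.label (f x)) n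
      {x | v ≤ (f x).1} := by
  classical
  have hfin := M.finite
  induction n generalizing v with
  | zero =>
    intro x hx y hy
    exact f.injective (Subtype.ext ((hv _ hx).antisymm hx |>.trans ((hv _ hy).antisymm hy).symm))
  | succ n ih =>
    have tot : ∀ a b x : M.tree, a ≤ x → b ≤ x → a ≤ b ∨ b ≤ a := fun a b x ha hb =>
      (le_total_of_directed ha hb).symm
    -- Within the leaves under `v`, the classes are the sets of leaves under one child of `v`.
    -- Leaves in different classes have least common ancestor exactly `v`.
    refine ⟨⟨fun x y => x = y ∨ v < (f x).1 ⊓ (f y).1, ?_, ?_, ?_⟩, M.C v, ?_, ?_⟩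
    · exact fun x => .inl rfl
    · rintro x y (h | h)
      · exact .inl h.symm
      · exact .inr (inf_comm (f x).1 (f y).1 ▸ h)
    · rintro x y z (rfl | h1) (rfl | h2)
      · exact .inl rfl
      · exact .inr h2
      · exact .inr h1
      · right
        rcases tot _ _ (f y).1 inf_le_right inf_le_left with h | h
        · exact h1.trans_le (le_inf inf_le_left (h.trans inf_le_right))
        · exact h2.trans_le (le_inf (h.trans inf_le_left) inf_le_right)
    · intro x hx
      rcases eq_or_lt_of_le (show v ≤ (f x).1 from hx) with h | h
      · have hsub : ({y ∈ {y | v ≤ (f y).1} | x = y ∨ v < (f x).1 ⊓ (f y).1} : Set V) ⊆ {x} := by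
          rintro y ⟨-, rfl | hy⟩
          · rfl
          · exact absurd (hy.trans_le inf_le_left) (h ▸ lt_irrefl _)
        exact (Layered.of_subsingleton n Set.subsingleton_singleton).mono hsub
      · obtain ⟨w, hvw, hwx⟩ := exists_covBy_le_of_lt h
        refine (ih w fun z hz => ?_).mono (T := {y | w ≤ (f y).1}) ?_
        · have h1 := hv z (hvw.le.trans hz)
          rw [Function.iterate_succ_apply'] at h1
          rcases tot _ _ z (Order.pred_iterate_le n z) hz with h2 | h2
          · exact h2
          · rcases eq_or_lt_of_le h2 with h3 | h3
            · exact h3.ge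
            · exact absurd (hvw.lt.trans_le ((Order.le_pred_of_lt h3).trans h1)) (lt_irrefl _)
        · rintro y ⟨-, rfl | hy⟩
          · exact hwx
          · rcases tot _ _ _ hwx (inf_le_left : (f x).1 ⊓ (f y).1 ≤ _) with h1 | h1
            · exact h1.trans inf_le_right
            · rcases eq_or_lt_of_le h1 with h2 | h2
              · exact h2 ▸ inf_le_right
              · exact absurd h2 (hvw.2 hy)
    · intro x hx y hy hxy
      change ¬ (x = y ∨ v < (f x).1 ⊓ (f y).1) at hxy
      push Not at hxy
      have hinf : (f x).1 ⊓ (f y).1 = v :=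
        ((eq_or_lt_of_le (le_inf hx hy)).resolve_right hxy.2).symm
      change f x ≠ f y ∧ M.C ((f x).1 ⊓ (f y).1) _ _ ↔ _
      rw [hinf]
      exact and_iff_right (f.injective.ne hxy.1)

/-! ### Bounded diameter and parent functions -/

/-- A chord would replace at least two edges by one and shorten a shortest walk. Shortest walks are
thus subject to the bound on induced paths. -/
lemma SimpleGraph.not_adj_getVert_of_length_eq_dist {V : Type u} {G : SimpleGraph V} {u v : V}
    (w : G.Walk u v) (hw : w.length = G.dist u v) {i j : ℕ} (hij : i + 2 ≤ j)
    (hj : j ≤ w.length) : ¬ G.Adj (w.getVert i) (w.getVert j) := by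
  intro h
  have := SimpleGraph.dist_le ((w.take i).append (.cons h (w.drop j)))
  simp only [SimpleGraph.Walk.length_append, SimpleGraph.Walk.length_cons,
    SimpleGraph.Walk.take_length, SimpleGraph.Walk.drop_length] at this
  omega

/-- The diameters of the components of layered graphs are bounded. -/
theorem Layered.exists_dist_bound (Λ : Type) [Finite Λ] (n : ℕ) :
    ∃ d : ℕ, ∀ {V : Type u} {G : SimpleGraph V} {lab : V → Λ}, Layered G.Adj lab n Set.univ →
      ∀ u v, G.dist u v ≤ d := by
  obtain ⟨d, hd⟩ := Layered.exists_path_bound.{u} Λ n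
  refine ⟨d, fun {V G lab} h u v => ?_⟩
  by_cases huv : G.Reachable u v
  · obtain ⟨w, hw⟩ := huv.exists_walk_length_eq_dist
    rw [← hw]
    exact hd h (fun _ _ h => h.symm) w.length w.getVert (fun _ _ => trivial)
      (fun i hi => w.adj_getVert_succ hi)
      fun i j hij hj => SimpleGraph.not_adj_getVert_of_length_eq_dist w hw hij hj
  · rw [SimpleGraph.dist_eq_zero_of_not_reachable huv]
    exact Nat.zero_le d

/-- The sets `U 0, U 2, …` tell each vertex which of the sets `U 1, U 3, …` contains its only
neighbour that is to be its parent; the vertices in none of them are their own parents. -/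
def ParentRel {V : Type u} (E : V → V → Prop) (N : ℕ) (U : ℕ → Set V) (x y : V) : Prop :=
  (∃ k < N, x ∈ U (2 * k) ∧ E x y ∧ y ∈ U (2 * k + 1)) ∨
    (x = y ∧ ¬ ∃ k < N, x ∈ U (2 * k))

/-- The sets `U` define a parent function whose `d`-th iterate identifies exactly the vertices of
the same component. -/
def Guides {V : Type u} (E : V → V → Prop) (N d : ℕ) (U : ℕ → Set V) : Prop :=
  ∃ π : V → V, (∀ x y, ParentRel E N U x y ↔ y = π x) ∧
    ∀ v w, π^[d] v = π^[d] w ↔ Relation.ReflTransGen E v w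

/-- The penultimate vertex of a shortest walk serves. With `u` a root, it witnesses a neighbour of
`v` in the preceding breadth-first layer. -/
lemma SimpleGraph.exists_adj_dist_eq {V : Type u} {G : SimpleGraph V} {u v : V}
    (h : G.Reachable u v) (hne : G.dist u v ≠ 0) :
    ∃ y, G.Adj v y ∧ G.dist u y = G.dist u v - 1 := by
  obtain ⟨w, hw⟩ := h.exists_walk_length_eq_dist
  have hadj := w.adj_getVert_succ (i := w.length - 1) (by omega)
  rw [show w.length - 1 + 1 = w.length by omega, w.getVert_length] at hadj
  refine ⟨_, hadj.symm, le_antisymm ?_ ?_⟩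
  · have := SimpleGraph.dist_le (w.take (w.length - 1))
    rw [SimpleGraph.Walk.take_length] at this
    omega
  · obtain ⟨p, hp⟩ := (h.trans hadj.symm.reachable).exists_walk_length_eq_dist
    have := SimpleGraph.dist_le (p.concat hadj)
    rw [SimpleGraph.Walk.length_concat] at this
    omega

/-- Boundedly many sets guide the layered graphs to representatives of their components. -/
theorem Layered.exists_guides (Λ : Type) [Finite Λ] (n : ℕ) :
    ∃ N d : ℕ, ∀ {V : Type u} {G : SimpleGraph V} {lab : V → Λ}, Layered G.Adj lab n Set.univ →
      ∃ U, Guides G.Adj N d U := by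
  classical
  obtain ⟨d, hd⟩ := Layered.exists_dist_bound.{u} Λ n
  obtain ⟨ι, hι, hun⟩ := Layered.exists_unique_neighbor.{u} Λ n
  obtain ⟨m, ⟨e⟩⟩ := Finite.exists_equiv_fin ι
  refine ⟨d * m, d, fun {V G lab} h => ?_⟩
  let root : V → V := fun v => (G.connectedComponentMk v).out
  have hroot : ∀ v, G.Reachable (root v) v := fun v =>
    SimpleGraph.ConnectedComponent.exact (Quot.out_eq (G.connectedComponentMk v))
  have root_eq : ∀ v w, G.Reachable v w → root v = root w := fun v w hvw =>
    congrArg Quot.out (SimpleGraph.ConnectedComponent.sound hvw)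
  let L : V → ℕ := fun v => G.dist (root v) v
  have hL : ∀ v, L v ≤ d := fun v => hd h _ _
  have hBs := fun i => hun h {y | L y = i} (Set.subset_univ _)
  choose Bs hsub hBs using hBs
  have hpar : ∀ x, L x ≠ 0 → ∃ (j : ι) (y : V), (y ∈ Bs (L x - 1) j ∧ G.Adj x y) ∧
      ∀ z, z ∈ Bs (L x - 1) j ∧ G.Adj x z → z = y := by
    intro x hx
    obtain ⟨y, hxy, hy⟩ := SimpleGraph.exists_adj_dist_eq (hroot x) hx
    obtain ⟨j, z, hz⟩ := hBs (L x - 1) x trivial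
      ⟨y, by change G.dist (root y) y = _; rw [← root_eq x y hxy.reachable]; exact hy, hxy⟩
    exact ⟨j, z, hz⟩
  choose J p hp hpu using hpar
  -- The pair of parent layer, at most `d - 1`, and subset index, below `m`, is written as one
  -- number below `d * m`.
  let code : ∀ x, L x ≠ 0 → ℕ := fun x hx => (L x - 1) * m + e (J x hx)
  have code_lt : ∀ x hx, code x hx < d * m := fun x hx => by
    have h1 := Nat.mul_le_mul_right m (show L x - 1 + 1 ≤ d by have := hL x; omega)
    have h2 := (e (J x hx)).2
    rw [Nat.succ_mul] at h1
    change (L x - 1) * m + _ < _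
    omega
  have code_div : ∀ x hx, code x hx / m = L x - 1 := fun x hx => by
    have h2 := (e (J x hx)).2
    change ((L x - 1) * m + _) / m = _
    rw [mul_comm, Nat.mul_add_div (by omega), Nat.div_eq_of_lt h2, add_zero]
  have code_mod : ∀ x hx, code x hx % m = e (J x hx) := fun x hx => by
    change ((L x - 1) * m + _) % m = _
    rw [mul_comm, Nat.mul_add_mod, Nat.mod_eq_of_lt (e (J x hx)).2]
  -- Even indices hold the vertices with a given code, odd indices the subset which that code names.
  let U : ℕ → Set V := fun t => if t % 2 = 0 then {x | ∃ hx, code x hx = t / 2}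
    else {y | ∃ j, (e j : ℕ) = t / 2 % m ∧ y ∈ Bs (t / 2 / m) j}
  have hU0 : ∀ k x, x ∈ U (2 * k) ↔ ∃ hx, code x hx = k := fun k x => by
    simp [U]
  have hU1 : ∀ k y, y ∈ U (2 * k + 1) ↔ ∃ j, (e j : ℕ) = k % m ∧ y ∈ Bs (k / m) j := fun k y => by
    have h1 : (2 * k + 1) % 2 ≠ 0 := by omega
    have h2 : (2 * k + 1) / 2 = k := by omega
    simp only [U, if_neg h1, h2, Set.mem_ofPred_eq]
  have hcode : ∀ x hx y, y ∈ U (2 * code x hx + 1) ↔ y ∈ Bs (L x - 1) (J x hx) := by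
    intro x hx y
    rw [hU1, code_div, code_mod]
    constructor
    · rintro ⟨j, hj, hy⟩
      rwa [← e.injective (Fin.ext hj)]
    · exact fun hy => ⟨_, rfl, hy⟩
  let π : V → V := fun x => if hx : L x ≠ 0 then p x hx else x
  have hπ1 : ∀ x (hx : L x ≠ 0), π x = p x hx := fun x hx => dif_pos hx
  have hπ0 : ∀ x (_ : L x = 0), π x = x := fun x hx => dif_neg (not_not.2 hx)
  have hstep : ∀ x, root (π x) = root x ∧ L (π x) = L x - 1 := by
    intro x
    by_cases hx : L x = 0
    · rw [hπ0 x hx, hx]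
      exact ⟨rfl, rfl⟩
    · rw [hπ1 x hx]
      exact ⟨(root_eq _ _ (hp x hx).2.reachable).symm, hsub _ _ (hp x hx).1⟩
  have hiter : ∀ k x, root (π^[k] x) = root x ∧ L (π^[k] x) = L x - k := by
    intro k x
    induction k with
    | zero => exact ⟨rfl, rfl⟩
    | succ k ih =>
      rw [Function.iterate_succ_apply', (hstep _).1, (hstep _).2, ih.1, ih.2]
      exact ⟨rfl, by omega⟩
  have hend : ∀ x, π^[d] x = root x := fun x => by
    have h1 := (hiter d x).2
    rw [Nat.sub_eq_zero_of_le (hL x)] at h1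
    -- Unreachable vertices also have distance 0, so reachability from the root is needed to
    -- conclude equality.
    rw [← (hroot _).dist_eq_zero_iff.1 h1, (hiter d x).1]
  refine ⟨U, π, fun x y => ?_, fun v w => ?_⟩
  · by_cases hx : L x = 0
    · have hno : ∀ k, x ∉ U (2 * k) := fun k hk => ((hU0 k x).1 hk).1 hx
      simp [ParentRel, hno, hπ0 x hx, eq_comm]
    · rw [hπ1 x hx]
      constructor
      · rintro (⟨k, hk, hxk, hadj, hy⟩ | ⟨-, hno⟩)
        · obtain ⟨_, rfl⟩ := (hU0 k x).1 hxk
          exact hpu x hx y ⟨(hcode x hx y).1 hy, hadj⟩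
        · exact absurd ⟨code x hx, code_lt x hx, (hU0 _ x).2 ⟨hx, rfl⟩⟩ hno
      · rintro rfl
        exact .inl ⟨code x hx, code_lt x hx, (hU0 _ x).2 ⟨hx, rfl⟩, (hp x hx).2,
          (hcode x hx _).2 (hp x hx).1⟩
  · rw [hend, hend, ← SimpleGraph.reachable_iff_reflTransGen]
    exact ⟨fun hvw => (hroot v).symm.trans (hvw ▸ hroot w), root_eq v w⟩

/-- Boundedly many sets guide the graphs of a class of bounded shrubdepth to representatives of
their components. -/
theorem BoundedShrubdepth.exists_guides {𝒞 : Set FinGraph.{u}} (h𝒞 : BoundedShrubdepth 𝒞) :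
    ∃ N d : ℕ, ∀ G ∈ 𝒞, ∃ U, Guides G.graph.Adj N d U := by
  obtain ⟨h, Λ, _, hM⟩ := h𝒞
  obtain ⟨N, d, hg⟩ := Layered.exists_guides.{u} Λ h
  refine ⟨N, d, fun G hG => ?_⟩
  obtain ⟨M, hdepth, ⟨f⟩⟩ := hM G hG
  have hlay := M.layered f.toEquiv h ⊥ fun x _ => (hdepth x).le
  have hadj : (fun x y => M.graph.Adj (f.toEquiv x) (f.toEquiv y)) = G.graph.Adj := by
    ext x y
    exact f.map_adj_iff
  rw [hadj] at hlay
  exact hg (hlay.mono fun x _ => bot_le)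

/-! ### Adding and removing symbols -/

lemma FinStr.mk_congr {sig sig' : Signature} {V : Type u} {hV hV' : Finite V}
    {rel rel' : (R : RelSym) → (Fin R.arity → V) → Prop} {fn fn' : FunSym → V → Option V}
    {h₁ h₂ h₁' h₂'} (hr : sig.rels = sig'.rels) (hf : sig.fns = sig'.fns) (hrel : rel = rel')
    (hfn : fn = fn') :
    FinStr.mk sig V hV rel fn h₁ h₂ = FinStr.mk sig' V hV' rel' fn' h₁' h₂' := by
  obtain ⟨_, _⟩ := sig
  obtain ⟨_, _⟩ := sig'
  subst hr hf hrel hfn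
  rfl

/-- `A` with the unary predicates named `0, …, n - 1` added and interpreted by `U`. -/
def FinStr.addPreds (A : FinStr.{u}) (n : ℕ) (U : ℕ → Set A.V) : FinStr.{u} where
  sig := ⟨A.sig.rels ∪ (Finset.range n).image fun k => ⟨k, 1⟩, A.sig.fns⟩
  V := A.V
  finite := A.finite
  rel := fun R v => A.rel R v ∨ ∃ h : R.arity = 1, R.name < n ∧ v (Fin.cast h.symm 0) ∈ U R.name
  fn := A.fn
  rel_eq_false := by
    rintro ⟨k, m⟩ h
    simp only [Finset.mem_union, Finset.mem_image, Finset.mem_range, not_or, RelSym.mk.injEq] at h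
    funext v
    rw [A.rel_eq_false _ h.1, false_or, eq_iff_iff, iff_false]
    rintro ⟨hm, hk, -⟩
    exact h.2 ⟨k, hk, rfl, hm.symm⟩
  fn_eq_none := A.fn_eq_none

/-- `A` has no unary relation symbols. -/
def FinStr.NoUnary (A : FinStr.{u}) : Prop := ∀ k : ℕ, (⟨k, 1⟩ : RelSym) ∉ A.sig.rels

namespace FinStr

variable {A : FinStr.{u}} {U : ℕ → Set A.V}

lemma addRel_rel_of_ne {R R' : RelSym} (h : R' ≠ R) (P : (Fin R.arity → A.V) → Prop) :
    (A.addRel R P).rel R' = A.rel R' :=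
  Function.update_of_ne h _ _

lemma addFn_fn_self (f : FunSym) (F : A.V → Option A.V) : (A.addFn f F).fn f = F :=
  Function.update_self ..

lemma addFn_fn_of_ne {f f' : FunSym} (h : f' ≠ f) (F : A.V → Option A.V) :
    (A.addFn f F).fn f' = A.fn f' :=
  Function.update_of_ne h _ _

lemma addPreds_zero : A.addPreds 0 U = A := by
  refine mk_congr (rel' := A.rel) (V := A.V) ?_ rfl ?_ rfl
  · simp
  · simp

lemma NoUnary.not_mem (hA : A.NoUnary) (n : ℕ) :
    (⟨n, 1⟩ : RelSym) ∉ (A.addPreds n U).sig.rels := by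
  simp [addPreds, hA n]

lemma addPreds_succ (hA : A.NoUnary) (n : ℕ) :
    A.addPreds (n + 1) U = (A.addPreds n U).addRel ⟨n, 1⟩ (fun v => v 0 ∈ U n) := by
  refine mk_congr ?_ rfl ?_ rfl
  · simp [addPreds, Finset.range_add_one]
  · funext R v
    by_cases h : R = ⟨n, 1⟩
    · subst h
      rw [Function.update_self, A.rel_eq_false _ (hA n)]
      simp only [false_or, Nat.lt_succ_self, true_and, exists_true_left, eq_iff_iff]
      rfl
    · rw [Function.update_of_ne h]
      have : R.arity = 1 → R.name ≠ n := fun h1 h2 => h (by cases R; simp_all)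
      simp only [addPreds, eq_iff_iff]
      refine or_congr_right (exists_congr fun h1 => and_congr_left fun _ => ?_)
      have := this h1
      omega

lemma dropRel_addPreds (hA : A.NoUnary) (n : ℕ) :
    (A.addPreds (n + 1) U).dropRel ⟨n, 1⟩ = A.addPreds n U := by
  have hn := hA.not_mem (U := U) n
  rw [addPreds_succ hA]
  refine mk_congr (Finset.erase_insert hn) rfl ?_ rfl
  funext R v
  by_cases h : R = ⟨n, 1⟩
  · subst h
    rw [Function.update_self]
    exact (congrFun ((A.addPreds n U).rel_eq_false _ hn) v).symm
  · rw [Function.update_of_ne h]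
    exact congrFun (addRel_rel_of_ne h _) v

lemma addPreds_rel_unary (hA : A.NoUnary) {n k : ℕ} (hk : k < n) (v : Fin 1 → A.V) :
    (A.addPreds n U).rel ⟨k, 1⟩ v ↔ v 0 ∈ U k := by
  change A.rel ⟨k, 1⟩ v ∨ _ ↔ _
  rw [A.rel_eq_false _ (hA k)]
  simp [hk]

lemma addPreds_rel_edgeSym (n : ℕ) : (A.addPreds n U).rel edgeSym = A.rel edgeSym := by
  funext v
  simp [addPreds, edgeSym]

/-- This discards the auxiliary parent function once its iterate is stored. As `f` was absent from
`A`, it was undefined everywhere there, which is what removal restores. -/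
lemma addFn_addFn_dropFn {f g : FunSym} (hfg : f ≠ g) (hf : f ∉ A.sig.fns)
    (F G : A.V → Option A.V) : ((A.addFn f F).addFn g G).dropFn f = A.addFn g G := by
  refine mk_congr rfl ?_ rfl ?_
  · change (insert g (insert f A.sig.fns)).erase f = insert g A.sig.fns
    rw [Finset.erase_insert_of_ne hfg.symm, Finset.erase_insert hf]
  · funext f'
    by_cases h : f' = f
    · subst h
      rw [Function.update_self, Function.update_of_ne hfg]
      exact (A.fn_eq_none _ hf).symm
    · rw [Function.update_of_ne h]
      by_cases h' : f' = g
      · subst h'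
        exact (addFn_fn_self ..).trans (addFn_fn_self ..).symm
      · rw [Function.update_of_ne h']
        exact (addFn_fn_of_ne h' _).trans (addFn_fn_of_ne h _)

end FinStr

/-! ### Formulas -/

namespace FOFormula

variable {A : FinStr.{u}} {n : ℕ}

/-- The formula saying that the `i`-th variable satisfies the unary predicate named `k`. -/
def unary (k : ℕ) (i : Fin n) : FOFormula n := .rel ⟨k, 1⟩ fun _ => .var i

/-- The formula saying that the `i`-th and the `j`-th variable are adjacent. -/
def edge (i j : Fin n) : FOFormula n := .rel edgeSym (![.var i, .var j] : Fin 2 → FOTerm n)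

/-- The disjunction of the first `m` formulas of a sequence. -/
def bigOr (φ : ℕ → FOFormula n) : ℕ → FOFormula n
  | 0 => .falsum
  | m + 1 => (bigOr φ m).or (φ m)

lemma holds_unary {k : ℕ} {i : Fin n} {x : Fin n → A.V} :
    (unary k i).Holds A x ↔ A.rel ⟨k, 1⟩ (fun _ => x i) := by
  constructor
  · rintro ⟨v, hv, h⟩
    have : v = fun _ => x i := funext fun t => (Option.some.inj (hv t)).symm
    exact this ▸ h
  · exact fun h => ⟨_, fun _ => rfl, h⟩

lemma holds_edge {i j : Fin n} {x : Fin n → A.V} :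
    (edge i j).Holds A x ↔ A.rel edgeSym (![x i, x j] : Fin 2 → A.V) := by
  constructor
  · rintro ⟨v, hv, h⟩
    have : v = (![x i, x j] : Fin 2 → A.V) := by
      funext (t : Fin 2)
      have := hv t
      fin_cases t <;> exact (Option.some.inj this).symm
    exact this ▸ h
  · refine fun h => ⟨(![x i, x j] : Fin 2 → A.V), fun (t : Fin 2) => ?_, h⟩
    fin_cases t <;> rfl

lemma over_edge {S : Signature} {i j : Fin n} (h : edgeSym ∈ S.rels) : (edge i j).Over S := by
  refine ⟨h, fun (t : Fin 2) => ?_⟩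
  fin_cases t <;> trivial

lemma holds_bigOr {φ : ℕ → FOFormula n} {m : ℕ} {x : Fin n → A.V} :
    (bigOr φ m).Holds A x ↔ ∃ k < m, (φ k).Holds A x := by
  induction m with
  | zero => simp [bigOr, Holds]
  | succ m ih => simp [bigOr, Holds, ih, Nat.lt_succ_iff_lt_or_eq, or_and_right, exists_or,
      -Order.lt_add_one_iff]

lemma isQF_bigOr {φ : ℕ → FOFormula n} (h : ∀ k, (φ k).IsQF) (m : ℕ) : (bigOr φ m).IsQF := by
  induction m with
  | zero => trivial
  | succ m ih => exact ⟨ih, h m⟩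

lemma over_bigOr {S : Signature} {φ : ℕ → FOFormula n} {m : ℕ} (h : ∀ k < m, (φ k).Over S) :
    (bigOr φ m).Over S := by
  induction m with
  | zero => trivial
  | succ m ih => exact ⟨ih fun k hk => h k (hk.trans m.lt_succ_self), h m m.lt_succ_self⟩

/-- The formula defining `ParentRel`. -/
def parent (N : ℕ) : FOFormula 2 :=
  .or (bigOr (fun k => .and (unary (2 * k) 0) (.and (edge 0 1) (unary (2 * k + 1) 1))) N)
    (.and (.eq (.var 0) (.var 1)) (.neg (bigOr (fun k => unary (2 * k) 0) N)))

/-- The formula saying that the second variable is the value of the `d`-th iterate of the function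
named `0` at the first. -/
def iterEq (d : ℕ) : FOFormula 2 := .eq ((FOTerm.app 0)^[d] (.var 0)) (.var 1)

lemma isQF_parent (N : ℕ) : (parent N).IsQF :=
  ⟨isQF_bigOr (fun k => show (FOFormula.and (n := 2) (unary (2 * k) 0)
      (.and (edge 0 1) (unary (2 * k + 1) 1))).IsQF from ⟨trivial, trivial, trivial⟩) N, trivial,
    isQF_bigOr (fun k => show (unary (n := 2) (2 * k) 0).IsQF from trivial) N⟩

end FOFormula

/-! ### The transduction -/

lemma uniqueChoice_eq {V : Type u} {Q : V → V → Prop} {π : V → V}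
    (h : ∀ x y, Q x y ↔ y = π x) : uniqueChoice Q = fun x => some (π x) := by
  funext x
  have hx : ∃! y, Q x y := ⟨π x, (h x _).2 rfl, fun y hy => (h x y).1 hy⟩
  rw [uniqueChoice, dif_pos hx, (h x _).1 hx.choose_spec.1]

/-- The edge relation of a structure. -/
def FinStr.edgeRel (A : FinStr.{u}) (x y : A.V) : Prop :=
  A.rel edgeSym (![x, y] : Fin 2 → A.V)

open Classical in
/-- A sequence of sets guiding `E`, if there is any. -/
noncomputable def guideSets {V : Type u} (N d : ℕ) (E : V → V → Prop) : ℕ → Set V :=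
  Classical.epsilon (Guides E N d)

/-- The unary lift by the `k`-th guiding set. -/
noncomputable def liftGuide (N d k : ℕ) : AtomicOp.{u} :=
  .lift k (fun A => {guideSets N d A.edgeRel k}) fun _ => Set.singleton_nonempty _

namespace Transduction

/-- `J` preceded by the lifts by the first `n` guiding sets. -/
noncomputable def withGuides (N d : ℕ) : ℕ → Transduction.{u} → Transduction.{u}
  | 0, J => J
  | n + 1, J => withGuides N d n (.comp (.atomic (liftGuide N d n)) J)

/-- `J` followed by the removal of the unary predicates named `0, …, n - 1`. -/
def dropPreds : ℕ → Transduction.{u} → Transduction.{u}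
  | 0, J => J
  | n + 1, J => dropPreds n (.comp J (.atomic (.relReduct ⟨n, 1⟩)))

lemma IsAlmostQF.withGuides {J : Transduction.{u}} (hJ : J.IsAlmostQF) (N d n : ℕ) :
    (withGuides N d n J).IsAlmostQF := by
  induction n generalizing J with
  | zero => exact hJ
  | succ n ih => exact ih ⟨trivial, hJ⟩

lemma IsAlmostQF.dropPreds {J : Transduction.{u}} (hJ : J.IsAlmostQF) (n : ℕ) :
    (dropPreds n J).IsAlmostQF := by
  induction n generalizing J with
  | zero => exact hJ
  | succ n ih => exact ih ⟨hJ, trivial⟩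

/-- The sets must guide jointly although they are lifted one at a time. Each lift chooses the whole
sequence from the edge relation alone, which earlier predicates leave unchanged, so all lifts agree
on it. Passing `J` as a continuation spares an identity transduction at `n = 0`. -/
lemma outputs_withGuides {A : FinStr.{u}} (hA : A.NoUnary) (N d n : ℕ) (J : Transduction.{u}) :
    (withGuides N d n J).outputs A = J.outputs (A.addPreds n (guideSets N d A.edgeRel)) := by
  induction n generalizing J with
  | zero => rw [FinStr.addPreds_zero]; rfl
  | succ n ih =>
    refine (ih _).trans ?_
    have hE : (A.addPreds n (guideSets N d A.edgeRel)).edgeRel = A.edgeRel := by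
      funext x y
      exact congrFun (FinStr.addPreds_rel_edgeSym n) _
    have hlift : (liftGuide N d n).outputs (A.addPreds n (guideSets N d A.edgeRel)) =
        {A.addPreds (n + 1) (guideSets N d A.edgeRel)} := by
      ext B
      rw [FinStr.addPreds_succ hA]
      constructor
      · rintro ⟨-, T, hT, rfl⟩
        rw [Set.mem_singleton_iff.1 hT, hE]
        rfl
      · rintro rfl
        refine ⟨hA.not_mem n, _, rfl, ?_⟩
        rw [hE]
        rfl
    change {B | ∃ A' ∈ (liftGuide N d n).outputs _, B ∈ J.outputs A'} = _
    rw [hlift]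
    simp

lemma outputs_dropPreds {A B : FinStr.{u}} (hB : B.NoUnary) {n : ℕ} {U : ℕ → Set B.V}
    {J : Transduction.{u}} (hJ : J.outputs A = {B.addPreds n U}) :
    (dropPreds n J).outputs A = {B} := by
  induction n generalizing J with
  | zero => rwa [FinStr.addPreds_zero] at hJ
  | succ n ih =>
    refine ih ?_
    change {C | ∃ A' ∈ J.outputs A, (⟨n, 1⟩ : RelSym) ∈ A'.sig.rels ∧ C = A'.dropRel ⟨n, 1⟩} = _
    rw [hJ]
    ext C
    have : (⟨n, 1⟩ : RelSym) ∈ (B.addPreds (n + 1) U).sig.rels := by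
      simp [FinStr.addPreds]
    simp [FinStr.dropRel_addPreds hB, this]

/-- From structures with guiding sets, compute the representatives by iterating the parent
function. -/
def representatives (N d : ℕ) : Transduction.{u} :=
  .comp (.comp (.atomic (.fnExtension 0 (.parent N))) (.atomic (.fnExtension 1 (.iterEq d))))
    (.atomic (.fnReduct 0))

lemma isAlmostQF_representatives (N d : ℕ) : (representatives.{u} N d).IsAlmostQF :=
  ⟨⟨FOFormula.isQF_parent N, trivial⟩, trivial⟩

end Transduction

lemma FOFormula.holds_parent {A : FinStr.{u}} (hA : A.NoUnary) (N : ℕ) (U : ℕ → Set A.V)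
    (x y : A.V) : (parent N).Holds (A.addPreds (2 * N) U) ![x, y] ↔
      ParentRel A.edgeRel N U x y := by
  have h0 : ∀ k < N, (unary (2 * k) 0).Holds (A.addPreds (2 * N) U) ![x, y] ↔ x ∈ U (2 * k) :=
    fun k hk => holds_unary.trans (FinStr.addPreds_rel_unary hA (by omega) _)
  have h1 : ∀ k < N, (unary (2 * k + 1) 1).Holds (A.addPreds (2 * N) U) ![x, y] ↔
      y ∈ U (2 * k + 1) :=
    fun k hk => holds_unary.trans (FinStr.addPreds_rel_unary hA (by omega) _)
  have hE : (edge 0 1).Holds (A.addPreds (2 * N) U) ![x, y] ↔ A.edgeRel x y :=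
    holds_edge.trans (iff_of_eq (congrFun (FinStr.addPreds_rel_edgeSym _) _))
  refine or_congr (holds_bigOr.trans ?_) (and_congr ?_ (not_congr (holds_bigOr.trans ?_)))
  · exact exists_congr fun k => and_congr_right fun hk =>
      and_congr (h0 k hk) (and_congr hE (h1 k hk))
  · constructor
    · rintro ⟨v, hx, hy⟩
      exact (Option.some.inj hx).trans (Option.some.inj hy).symm
    · exact fun h => ⟨x, rfl, congrArg some h.symm⟩
  · exact exists_congr fun k => and_congr_right fun hk => h0 k hk

lemma FOFormula.over_parent {S : Signature} {N : ℕ} (hE : edgeSym ∈ S.rels)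
    (hU : ∀ k < 2 * N, (⟨k, 1⟩ : RelSym) ∈ S.rels) : (parent N).Over S :=
  ⟨over_bigOr fun k hk => ⟨⟨hU _ (by omega), fun _ => trivial⟩, over_edge hE,
    hU _ (by omega), fun _ => trivial⟩, ⟨trivial, trivial⟩,
    over_bigOr fun k hk => ⟨hU _ (by omega), fun _ => trivial⟩⟩

lemma FOTerm.eval_iterate_app {A : FinStr.{u}} {f : FunSym} {π : A.V → A.V}
    (hf : A.fn f = fun x => some (π x)) {n : ℕ} (i : Fin n) (x : Fin n → A.V) (d : ℕ) :
    ((FOTerm.app f)^[d] (.var i)).eval A x = some (π^[d] (x i)) := by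
  induction d with
  | zero => rfl
  | succ d ih =>
    rw [Function.iterate_succ_apply', Function.iterate_succ_apply', FOTerm.eval, ih, hf]
    rfl

lemma FOFormula.holds_iterEq {A : FinStr.{u}} {π : A.V → A.V}
    (hf : A.fn 0 = fun x => some (π x)) (d : ℕ) (x y : A.V) :
    (iterEq d).Holds A ![x, y] ↔ y = π^[d] x := by
  constructor
  · rintro ⟨v, hx, hy⟩
    rw [FOTerm.eval_iterate_app hf] at hx
    exact (Option.some.inj hy).trans (Option.some.inj hx).symm
  · rintro rfl
    exact ⟨_, FOTerm.eval_iterate_app hf _ _ _, rfl⟩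

lemma FOFormula.over_iterEq {S : Signature} (h : 0 ∈ S.fns) (d : ℕ) : (iterEq d).Over S := by
  refine ⟨?_, trivial⟩
  induction d with
  | zero => trivial
  | succ d ih =>
    rw [Function.iterate_succ_apply']
    exact ⟨h, ih⟩

lemma Transduction.outputs_representatives {A : FinStr.{u}} (hA : A.NoUnary)
    (hE : edgeSym ∈ A.sig.rels) (hfn : A.sig.fns = ∅) {N : ℕ} (d : ℕ) {U : ℕ → Set A.V}
    {π : A.V → A.V} (hπ : ∀ x y, ParentRel A.edgeRel N U x y ↔ y = π x) :
    (representatives N d).outputs (A.addPreds (2 * N) U) =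
      {(A.addFn 1 fun x => some (π^[d] x)).addPreds (2 * N) U} := by
  let A₀ := A.addPreds (2 * N) U
  let A₁ := A₀.addFn 0 fun x => some (π x)
  let A₂ := A₁.addFn 1 fun x => some (π^[d] x)
  have h0 : 0 ∉ A₀.sig.fns := by
    change 0 ∉ A.sig.fns
    simp [hfn]
  have h1 : 1 ∉ A₁.sig.fns := by
    change 1 ∉ insert 0 A.sig.fns
    simp [hfn]
  have hover : (FOFormula.parent N).Over A₀.sig := by
    refine FOFormula.over_parent (Finset.mem_union_left _ hE) fun k hk => ?_
    exact Finset.mem_union_right _ (Finset.mem_image_of_mem _ (Finset.mem_range.2 hk))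
  have e1 : A₀.addFn 0 (uniqueChoice fun x y => (FOFormula.parent N).Holds A₀ ![x, y]) = A₁ :=
    congrArg (A₀.addFn 0)
      (uniqueChoice_eq fun x y => (FOFormula.holds_parent hA N U x y).trans (hπ x y))
  have e2 : A₁.addFn 1 (uniqueChoice fun x y => (FOFormula.iterEq d).Holds A₁ ![x, y]) = A₂ :=
    congrArg (A₁.addFn 1)
      (uniqueChoice_eq fun x y => FOFormula.holds_iterEq (FinStr.addFn_fn_self 0 _) d x y)
  -- Adding predicates and adding functions commute by definition.
  have e3 : A₂.dropFn 0 = (A.addFn 1 fun x => some (π^[d] x)).addPreds (2 * N) U :=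
    FinStr.addFn_addFn_dropFn zero_ne_one h0 _ _
  have h2 : 0 ∈ A₂.sig.fns := Finset.mem_insert_of_mem (Finset.mem_insert_self _ _)
  have h3 : (FOFormula.iterEq d).Over A₁.sig :=
    FOFormula.over_iterEq (Finset.mem_insert_self _ _) d
  rw [← e3]
  ext B
  constructor
  · rintro ⟨_, ⟨_, ⟨-, -, rfl⟩, ⟨-, -, rfl⟩⟩, -, rfl⟩
    change FinStr.dropFn (FinStr.addFn (A₀.addFn 0 _) 1 _) 0 = _
    rw [e1, e2]
  · rintro rfl
    exact ⟨A₂, ⟨A₁, ⟨h0, hover, e1.symm⟩, ⟨h1, h3, e2.symm⟩⟩, h2, rfl⟩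

lemma FinGraph.noUnary_toStr (G : FinGraph.{u}) : G.toStr.NoUnary := by
  intro k
  simp [FinGraph.toStr, FinStr.addRel, edgeSym]

lemma FinGraph.edgeRel_toStr (G : FinGraph.{u}) : G.toStr.edgeRel = G.graph.Adj := by
  funext x y
  exact congrFun (Function.update_self edgeSym (fun v : Fin 2 → G.V => G.graph.Adj (v 0) (v 1))
    (fun _ _ => False : (R : RelSym) → (Fin R.arity → G.V) → Prop)) (![x, y] : Fin 2 → G.V)

theorem mainTheorem6 (𝒞 : Set FinGraph.{u}) (h𝒞 : BoundedShrubdepth 𝒞) :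
    ∃ (F : Transduction.{u}) (g : FunSym), F.IsAlmostQF ∧
      ∀ G ∈ 𝒞, (F.outputs G.toStr).Nonempty ∧
        ∀ B ∈ F.outputs G.toStr, ∃ γ : G.V → G.V,
          (∀ v w : G.V, γ v = γ w ↔ G.graph.Reachable v w) ∧
            B = G.toStr.addFn g (fun v => some (γ v)) := by
  obtain ⟨N, d, hguides⟩ := h𝒞.exists_guides
  refine ⟨.withGuides N d (2 * N) (.dropPreds (2 * N) (.representatives N d)), 1,
    ((Transduction.isAlmostQF_representatives N d).dropPreds _).withGuides N d _, fun G hG => ?_⟩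
  have hG' : Guides G.graph.Adj N d (guideSets N d G.graph.Adj) :=
    Classical.epsilon_spec (hguides G hG)
  obtain ⟨π, hπ, hreach⟩ := hG'
  rw [← G.edgeRel_toStr] at hπ
  have hout := (Transduction.outputs_withGuides G.noUnary_toStr N d (2 * N)
    (.dropPreds (2 * N) (.representatives N d))).trans
    (Transduction.outputs_dropPreds (B := G.toStr.addFn 1 fun x => some (π^[d] x))
      G.noUnary_toStr (Transduction.outputs_representatives G.noUnary_toStr
        (Finset.mem_insert_self _ _) rfl d hπ))
  rw [hout]
  refine ⟨Set.singleton_nonempty _, fun B hB => ⟨π^[d], fun v w => ?_, hB⟩⟩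
  rw [hreach, SimpleGraph.reachable_iff_reflTransGen]
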